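/- Let $X$ be a compact metric space, $T:X\to X$ a continuous map, and $M(T,X)$ the space of $T$-invariant Borel probability measures with the weak$^*$ topology. For $x\in X$ let $M_x\subseteq M(T,X)$ be the set of all weak$^*$ limits of subsequences of the empirical measures $\frac1n\sum_{j=0}^{n-1}\delta_{T^jx}$, let $\omega_T(x)$ be the $\omega$-limit set of $x$, and put $Tran=\{x\in X:\omega_T(x)=X\}$. For $\mu\in M(T,X)$ let $h_\mu$ be its metric (Kolmogorov–Sinai) entropy (logarithms to base $2$). For $E\subseteq X$ let $h_{top}(T,E)\in[0,\infty]$ be Bowen's topological entropy: with $B_m(x,\varepsilon)=\{y: d(T^jx,T^jy)\le\varepsilon,\ 0\le j\le m-1\}$, let $C(E;t,n,\varepsilon)$ be the infimum of $\sum 2^{-tm}$ over all finite or countable covers of $E$ by sets $B_m(x,\varepsilon)$ with $m\ge n$, let $C(E;t,\varepsilon)=\lim_{n\to\infty}C(E;t,n,\varepsilon)$, $h_{top}(E,\varepsilon)=\inf\{t\ge0: C(E;t,\varepsilon)=0\}$ and $h_{top}(T,E)=\lim_{\varepsilon\to0}h_{top}(E,\varepsilon)$ (so $h_{top}(T,\emptyset)=0$).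 Write $h_{top}(T)=h_{top}(T,X)$. For $K\subseteq M(T,X)$ put $G^T_K=\{x\in Tran: M_x=K\}$, and consider the property $$(*)\qquad G^T_K\ne\emptyset\quad\text{and}\quad h_{top}(T,G^T_K)=\inf\{h_\mu:\mu\in K\}.$$ The map $T$ is *transitively-convex-saturated* if $(*)$ holds for every nonempty compact connected $K\subseteq M(T,X)$ that is contained in the set of convex combinations of some finite family of invariant measures, and *transitively-single-saturated* if $(*)$ holds for every $K=\{\mu\}$, $\mu\in M(T,X)$. Let $\alpha:M(T,X)\to\mathbb R$ be continuous. Condition [A.3] says: whenever $\mu,\nu\in M(T,X)$ and $\alpha(\mu)\ne\alpha(\nu)$, the function $\theta\mapsto\alpha(\theta\mu+(1-\theta)\nu)$ is not constant on any nondegenerate subinterval of $[0,1]$. Put $$I_\alpha=\Big\{x\in X:\inf_{\mu\in M_x}\alpha(\mu)<\sup_{\mu\in M_x}\alpha(\mu)\Big\},\qquad R_\alpha(a)=\Big\{x\in X:\inf_{\mu\in M_x}\alpha(\mu)=\sup_{\mu\in M_x}\alpha(\mu)=a\Big\}\quad(a\in\mathbb R).$$ **Theorem.** (1) If $T$ is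 transitively-convex-saturated and $\alpha$ satisfies [A.3], then either $I_\alpha=\emptyset$ or $$h_{top}(T,I_\alpha\cap Tran)=h_{top}(T,I_\alpha)=h_{top}(T).$$ (2) If $T$ is transitively-single-saturated, then for every $a\in\mathbb R$ either $R_\alpha(a)=\emptyset$ or $$h_{top}(T,R_\alpha(a)\cap Tran)=h_{top}(T,R_\alpha(a))=\sup\{h_\rho:\rho\in M(T,X),\ \alpha(\rho)=a\}.$$ -/

import Mathlib

open MeasureTheory Filter Topology Set
open scoped NNReal ENNReal unitInterval

noncomputable section

namespace TopDyn

section InvariantMeasures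

variable {X : Type*} [TopologicalSpace X] [MeasurableSpace X]

/-- `M(T,X)`: the `T`-invariant Borel probability measures, with the topology of weak convergence
(the subspace topology of Mathlib's `ProbabilityMeasure X`). -/
abbrev InvMeasure (T : X → X) : Type _ :=
  {μ : ProbabilityMeasure X // MeasurePreserving T (μ : Measure X) (μ : Measure X)}

/-- The underlying measure of an invariant measure. -/
abbrev InvMeasure.meas {T : X → X} (μ : InvMeasure T) : Measure X := (μ.1 : Measure X)

/-- The convex combination `θ μ + (1 - θ) ν` of invariant measures, `θ ∈ [0,1]`. -/
def InvMeasure.mix {T : X → X} (θ : I) (μ ν : InvMeasure T) : InvMeasure T :=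
  ⟨⟨ENNReal.ofReal (θ : ℝ) • μ.meas + ENNReal.ofReal (1 - (θ : ℝ)) • ν.meas, ⟨by
      have h : ENNReal.ofReal (θ : ℝ) + ENNReal.ofReal (1 - (θ : ℝ)) = 1 := by
        rw [← ENNReal.ofReal_add θ.2.1 (sub_nonneg.2 θ.2.2)]
        simp
      simpa using h⟩⟩, ⟨μ.2.measurable, by
      have hμ : Measure.map T μ.meas = μ.meas := μ.2.map_eq
      have hν : Measure.map T ν.meas = ν.meas := ν.2.map_eq
      change Measure.map T (_ • μ.meas + _ • ν.meas) = _ • μ.meas + _ • ν.meas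
      rw [Measure.map_add _ _ μ.2.measurable, Measure.map_smul, Measure.map_smul, hμ, hν]⟩⟩

/-- The set of all convex sums `∑ i, w i • μ i` of the finitely many invariant measures `μ i`. -/
def convexSums {T : X → X} {m : ℕ} (μ : Fin m → InvMeasure T) : Set (InvMeasure T) :=
  {ν | ∃ w : Fin m → ℝ≥0, ∑ i, w i = 1 ∧ ν.meas = ∑ i, w i • (μ i).meas}

/-- The empirical measure `(1/(n+1)) ∑_{i=0}^{n} δ_{T^i x}` of the orbit segment of length
`n + 1` of `x`. -/
def empiricalMeasure (T : X → X) (x : X) (n : ℕ) : ProbabilityMeasure X :=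
  ⟨((n + 1 : ℕ) : ℝ≥0∞)⁻¹ • ∑ i ∈ Finset.range (n + 1), Measure.dirac (T^[i] x), ⟨by
    have h : (((n + 1 : ℕ) : ℝ≥0∞))⁻¹ * ((n + 1 : ℕ) : ℝ≥0∞) = 1 :=
      ENNReal.inv_mul_cancel (by simp) (ENNReal.natCast_ne_top _)
    simpa using h⟩⟩

/-- `M_x`: the limit set (the set of weak limits of subsequences) of the empirical measures of
`x`. For a continuous `T` on a compact metric space every such limit is `T`-invariant, so nothing
is lost by regarding `M_x` as a subset of `M(T,X)`. -/
def limitMeasures [OpensMeasurableSpace X] (T : X → X) (x : X) : Set (InvMeasure T) :=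
  {μ | ∃ φ : ℕ → ℕ, StrictMono φ ∧
    Tendsto (fun k => empiricalMeasure T x (φ k)) atTop (𝓝 μ.1)}

/-- `Tran`: the points whose `ω`-limit set is the whole space. -/
def Tran (T : X → X) : Set X :=
  {x | omegaLimit atTop (fun (n : ℕ) (y : X) => T^[n] y) {x} = univ}

/-- `G^T_K = {x ∈ Tran | M_x = K}`. -/
def tranSaturatedSet [OpensMeasurableSpace X] (T : X → X) (K : Set (InvMeasure T)) : Set X :=
  {x | x ∈ Tran T ∧ limitMeasures T x = K}

end InvariantMeasures

section MetricEntropy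

variable {X : Type*} [MeasurableSpace X]

/-- The Shannon entropy, to base `2`, of the partition `⋁_{i=0}^{n-1} T^{-i} ξ`. A finite measurable
partition is given by a measurable map `ξ : X → Fin k`, its cells being the fibres of `ξ`; the
cells of the refinement are indexed by words `w`. (Empty cells contribute `0 log 0 = 0`.) -/
def partitionEntropy (T : X → X) (μ : Measure X) {k : ℕ} (ξ : X → Fin k) (n : ℕ) : ℝ :=
  -∑ w : Fin n → Fin k, μ.real {x | ∀ i : Fin n, ξ (T^[i] x) = w i} *
    Real.logb 2 (μ.real {x | ∀ i : Fin n, ξ (T^[i] x) = w i})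

/-- `h(T, μ, ξ) = lim (1/n) H(μ, ⋁_{i=0}^{n-1} T^{-i} ξ)`. For an invariant probability measure `μ`
the limit exists; it is written as an upper limit in `[0, ∞]`. -/
def entropyOfPartition (T : X → X) (μ : Measure X) {k : ℕ} (ξ : X → Fin k) : ℝ≥0∞ :=
  limsup (fun n : ℕ => ENNReal.ofReal (partitionEntropy T μ ξ n / n)) atTop

/-- The metric (Kolmogorov-Sinai) entropy `h_μ(T)`: the supremum of `h(T, μ, ξ)` over all finite
measurable partitions `ξ`. -/
def metricEntropy (T : X → X) (μ : Measure X) : ℝ≥0∞ :=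
  ⨆ (k : ℕ) (ξ : X → Fin k) (_ : Measurable ξ), entropyOfPartition T μ ξ

end MetricEntropy

section BowenEntropy

variable {X : Type*} [MetricSpace X]

/-- The dynamical ball `B_n(x, ε)`. -/
def bowenBall (T : X → X) (n : ℕ) (x : X) (ε : ℝ) : Set X :=
  {y | ∀ j < n, dist (T^[j] x) (T^[j] y) ≤ ε}

/-- The finite or countable families of dynamical balls `B_m(x, ε)`, `m ≥ n`, that cover `E`; the
ball `B_m(x, ε)` is recorded by the pair `(x, m)`. -/
def bowenCovers (T : X → X) (E : Set X) (n : ℕ) (ε : ℝ) : Set (Set (X × ℕ)) :=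
  {C | C.Countable ∧ (∀ p ∈ C, n ≤ p.2) ∧ E ⊆ ⋃ p ∈ C, bowenBall T p.2 p.1 ε}

/-- `C(E; t, n, ε, T)`, the infimum of `∑ 2^{-tm}` over such covers. -/
def bowenSum (T : X → X) (E : Set X) (t : ℝ) (n : ℕ) (ε : ℝ) : ℝ≥0∞ :=
  ⨅ C ∈ bowenCovers T E n ε, ∑' p : C, ENNReal.ofReal ((2 : ℝ) ^ (-t * (p.1.2 : ℝ)))

/-- `C(E; t, ε, T) = lim_{n → ∞} C(E; t, n, ε, T)`, a supremum because `C(E; t, n, ε, T)` is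
nondecreasing in `n`. -/
def bowenMeasure (T : X → X) (E : Set X) (t : ℝ) (ε : ℝ) : ℝ≥0∞ :=
  ⨆ n : ℕ, bowenSum T E t n ε

/-- `h_top(E, ε, T) = inf {t ≥ 0 | C(E; t, ε, T) = 0}`, an element of `[0, ∞]`. -/
def bowenEntropyAt (T : X → X) (E : Set X) (ε : ℝ) : ℝ≥0∞ :=
  ⨅ (t : ℝ≥0) (_ : bowenMeasure T E t ε = 0), (t : ℝ≥0∞)

/-- Bowen's topological entropy `h_top(T, E) = lim_{ε → 0} h_top(E, ε, T)` of an arbitrary subset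
`E`, a supremum because `h_top(E, ε, T)` is nonincreasing in `ε`. -/
def topEntropy (T : X → X) (E : Set X) : ℝ≥0∞ :=
  ⨆ (ε : ℝ) (_ : 0 < ε), bowenEntropyAt T E ε

end BowenEntropy

section Saturation

variable {X : Type*} [MetricSpace X] [MeasurableSpace X] [BorelSpace X]

/-- `G^T_K ≠ ∅` and `h_top(T, G^T_K) = inf {h_μ(T) | μ ∈ K}`. -/
def TranSaturatedOn (T : X → X) (K : Set (InvMeasure T)) : Prop :=
  (tranSaturatedSet T K).Nonempty ∧
    topEntropy T (tranSaturatedSet T K) = ⨅ μ ∈ K, metricEntropy T μ.meas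

/-- `T` is transitively-convex-saturated: the saturation property holds for all nonempty compact
connected `K ⊆ M(T,X)` that lie in the set of convex sums of finitely many invariant measures. -/
def TransitivelyConvexSaturated (T : X → X) : Prop :=
  ∀ K : Set (InvMeasure T), IsCompact K → IsConnected K →
    (∃ (m : ℕ) (μ : Fin m → InvMeasure T), K ⊆ convexSums μ) → TranSaturatedOn T K

/-- `T` is transitively-single-saturated: the saturation property holds for all singletons. -/
def TransitivelySingleSaturated (T : X → X) : Prop :=
  ∀ μ : InvMeasure T, TranSaturatedOn T {μ}

/-- Condition `[A.3]`: when `α μ ≠ α ν`, the function `θ ↦ α (θ μ + (1 - θ) ν)` is not constant on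
any (nondegenerate) subinterval of `[0,1]`. -/
def ConditionA3 {T : X → X} (α : InvMeasure T → ℝ) : Prop :=
  ∀ μ ν : InvMeasure T, α μ ≠ α ν → ∀ a b : I, a < b →
    ¬ ∃ c : ℝ, ∀ θ ∈ Icc a b, α (InvMeasure.mix θ μ ν) = c

/-- `I_α = {x | inf_{μ ∈ M_x} α μ < sup_{μ ∈ M_x} α μ}`. -/
def irregularSet {T : X → X} (α : InvMeasure T → ℝ) : Set X :=
  {x | sInf (α '' limitMeasures T x) < sSup (α '' limitMeasures T x)}

/-- `R_α(a) = {x | inf_{μ ∈ M_x} α μ = sup_{μ ∈ M_x} α μ = a}`. -/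
def levelSet {T : X → X} (α : InvMeasure T → ℝ) (a : ℝ) : Set X :=
  {x | sInf (α '' limitMeasures T x) = a ∧ sSup (α '' limitMeasures T x) = a}

end Saturation

end TopDyn

end

/-! The upper bounds come from Bowen's theorem, `topEntropy_le_of_forall_exists_limitMeasures`.
Applied to `X`, with `M_x` nonempty, it gives the needed half of the variational principle; applied
to `R_α(a)`, all of whose limit measures satisfy `α = a`, it gives the supremum over that level.

The lower bounds come from saturation. If `α ρ = a`, then `G_{ρ}` lies in `R_α(a) ∩ Tran` and has
entropy `h_ρ`. If `α μ ≠ α ν`, take for `K` the segment from `θμ + (1-θ)ν` to `μ`. By [A.3] `α` is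
not constant on `K`, so `G_K ⊆ I_α ∩ Tran`, and concavity of entropy gives `h ≥ θ h_μ` on `K`; let
`θ → 1`. A nonempty `I_α` supplies two measures with different `α`, and every `ρ` differs from at
least one of them.

Bowen's theorem is proved by coding. If `h_μ < c`, a fine partition with `μ`-null boundaries has
some increment `H_{N+1} - H_N < c`, so a strictly positive kernel predicting a letter from the `N`
preceding ones has mean code length below `c` under `μ`. This mean is continuous at `μ`, so it stays
below `c` for empirical measures near `μ`. A Kraft inequality then bounds the cost of covering the
points with such short codes. Countably many neighbourhoods suffice. -/

namespace TopDyn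

/-! ### Kraft inequality and prediction kernels on words -/

section Words

/-- For a kernel `G` of total mass at most one over each word of length `N`, the products of `G`
along the windows of the words of length `N + m` sum to at most the number of words of length
`N`. -/
lemma sum_prod_window_le {k N : ℕ} (G : (Fin (N + 1) → Fin k) → ℝ) (hG0 : ∀ v, 0 ≤ G v)
    (hG : ∀ w : Fin N → Fin k, ∑ b, G (Fin.snoc w b) ≤ 1) (m : ℕ) :
    ∑ a : Fin (N + m) → Fin k, ∏ i : Fin m, G (fun j => a ⟨i + j, by omega⟩) ≤ (k : ℝ) ^ N := by
  induction m with
  | zero => simp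
  | succ m ih =>
    refine le_trans ?_ ih
    refine ((Fin.snocEquiv (fun _ : Fin (N + m + 1) => Fin k)).sum_comp
      (fun a => ∏ i : Fin (m + 1), G (fun j => a ⟨i + j, by omega⟩))).symm.trans_le ?_
    rw [Fintype.sum_prod_type_right]
    refine Finset.sum_le_sum fun a _ => ?_
    -- Appending the letter `b` creates exactly one new window: the last `N` letters of `a` followed
    -- by `b`. Summing its factor over `b` gives at most one.
    have key : ∀ b : Fin k,
        (∏ i : Fin (m + 1), G (fun j => (Fin.snoc a b : Fin (N + m + 1) → Fin k)
          ⟨i + j, by omega⟩)) =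
        (∏ i : Fin m, G (fun j => a ⟨i + j, by omega⟩)) *
          G (Fin.snoc (fun j : Fin N => a ⟨m + j, by omega⟩) b) := by
      intro b
      rw [Fin.prod_univ_castSucc]
      congr 1
      · refine Finset.prod_congr rfl fun i _ => congrArg G (funext fun j => ?_)
        have : (i : ℕ) + j < N + m := by omega
        simp [Fin.snoc, this]
      · refine congrArg G (funext fun j => ?_)
        refine Fin.lastCases ?_ (fun j => ?_) j
        · simp [Fin.snoc, Nat.add_comm m N]
        · have : m + (j : ℕ) < N + m := by omega
          simp [Fin.snoc, this]
    calc _ = ∑ b : Fin k, (∏ i : Fin m, G (fun j => a ⟨i + j, by omega⟩)) *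
          G (Fin.snoc (fun j : Fin N => a ⟨m + j, by omega⟩) b) :=
        Finset.sum_congr rfl fun b _ => key b
      _ = (∏ i : Fin m, G (fun j => a ⟨i + j, by omega⟩)) *
          ∑ b, G (Fin.snoc (fun j : Fin N => a ⟨m + j, by omega⟩) b) := by
        rw [Finset.mul_sum]
      _ ≤ _ := mul_le_of_le_one_right (Finset.prod_nonneg fun _ _ => hG0 _) (hG _)

/-- At `x = 0` the logarithm is singular, but the unperturbed prefactor `x` makes the product
identically zero. -/
lemma tendsto_mul_logb_add (x C : ℝ) :
    Tendsto (fun η : ℝ => x * Real.logb 2 (x + C * η)) (𝓝 0) (𝓝 (x * Real.logb 2 x)) := by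
  rcases eq_or_ne x 0 with rfl | hx
  · simp
  · have h : Tendsto (fun η : ℝ => x + C * η) (𝓝 0) (𝓝 x) := by
      have : Continuous fun η : ℝ => x + C * η := by fun_prop
      simpa using this.tendsto 0
    have h2 : ContinuousAt (Real.logb 2) x := by
      unfold Real.logb
      exact (Real.continuousAt_log hx).div_const _
    exact (h2.tendsto.comp h).const_mul x

/-- A distribution on words of length `N + 1` has a strictly positive kernel whose relative code
length is as close as desired to the conditional entropy of the last letter. -/
lemma exists_pos_kernel {k N : ℕ} (p : (Fin (N + 1) → Fin k) → ℝ) (hp : ∀ v, 0 ≤ p v)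
    (q : (Fin N → Fin k) → ℝ) (hq : ∀ w, q w = ∑ b, p (Fin.snoc w b)) {c : ℝ}
    (hc : ∑ w, q w * Real.logb 2 (q w) - ∑ v, p v * Real.logb 2 (p v) < c) :
    ∃ G : (Fin (N + 1) → Fin k) → ℝ, (∀ v, 0 < G v) ∧
      (∀ w : Fin N → Fin k, ∑ b, G (Fin.snoc w b) ≤ 1) ∧
      ∑ v, p v * (-Real.logb 2 (G v)) < c := by
  -- Adding `η` to every `p v` adds `k * η` to every marginal `q w`. The quotient of the two is then
  -- a positive kernel, and its mean code length tends to the conditional entropy as `η` decreases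
  -- to 0.
  have hlim : Tendsto (fun η : ℝ => ∑ w, q w * Real.logb 2 (q w + k * η) -
      ∑ v, p v * Real.logb 2 (p v + 1 * η)) (𝓝[>] 0)
      (𝓝 (∑ w, q w * Real.logb 2 (q w) - ∑ v, p v * Real.logb 2 (p v))) :=
    ((tendsto_finsetSum _ fun w _ => tendsto_mul_logb_add _ _).sub
      (tendsto_finsetSum _ fun v _ => tendsto_mul_logb_add _ _)).mono_left nhdsWithin_le_nhds
  obtain ⟨η, hη, hη0⟩ := ((hlim.eventually_lt_const hc).and self_mem_nhdsWithin).exists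
  have hη0 : 0 < η := hη0
  have hq0 : ∀ w, 0 ≤ q w := fun w => by rw [hq]; exact Finset.sum_nonneg fun _ _ => hp _
  have hk : ∀ b : Fin k, (0 : ℝ) < k := fun b => by exact_mod_cast b.pos
  refine ⟨fun v => (p v + η) / (q (Fin.init v) + k * η), fun v => ?_, fun w => ?_, ?_⟩
  · have := hp v
    have := hq0 (Fin.init v)
    have := hk (v 0)
    positivity
  · simp only [Fin.init_snoc]
    rw [← Finset.sum_div, Finset.sum_add_distrib, ← hq]
    simpa using div_self_le_one (q w + k * η)
  · refine lt_of_eq_of_lt ?_ hη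
    have h1 : ∀ v : Fin (N + 1) → Fin k,
        p v * (-Real.logb 2 ((p v + η) / (q (Fin.init v) + k * η))) =
        p v * Real.logb 2 (q (Fin.init v) + k * η) - p v * Real.logb 2 (p v + 1 * η) := by
      intro v
      have := hp v
      have := hq0 (Fin.init v)
      have := hk (v 0)
      rw [Real.logb_div (by positivity) (by positivity)]
      ring_nf
    rw [Finset.sum_congr rfl fun v _ => h1 v, Finset.sum_sub_distrib]
    congr 1
    rw [← (Fin.snocEquiv (fun _ : Fin (N + 1) => Fin k)).sum_comp, Fintype.sum_prod_type_right]
    refine Finset.sum_congr rfl fun w _ => ?_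
    rw [hq w, Finset.sum_mul]
    refine Finset.sum_congr rfl fun b _ => ?_
    simp [Fin.snocEquiv, hq w]

end Words

/-! ### Bowen's outer measures and the covering estimate -/

section BowenSum

variable {X : Type*} [MetricSpace X] {T : X → X}

lemma bowenSum_mono {E F : Set X} (h : E ⊆ F) (t : ℝ) (n : ℕ) (ε : ℝ) :
    bowenSum T E t n ε ≤ bowenSum T F t n ε :=
  biInf_mono fun _ hC => ⟨hC.1, hC.2.1, h.trans hC.2.2⟩

lemma bowenSum_mono_nat (E : Set X) (t : ℝ) {n n' : ℕ} (h : n ≤ n') (ε : ℝ) :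
    bowenSum T E t n ε ≤ bowenSum T E t n' ε :=
  biInf_mono fun _ hC => ⟨hC.1, fun p hp => h.trans (hC.2.1 p hp), hC.2.2⟩

lemma bowenSum_empty (t : ℝ) (n : ℕ) (ε : ℝ) : bowenSum T ∅ t n ε = 0 := by
  refine le_antisymm ?_ zero_le
  refine (iInf₂_le (∅ : Set (X × ℕ)) ⟨countable_empty, by simp, by simp⟩).trans ?_
  simp

lemma bowenSum_le_of_subset_bowenBall {E : Set X} {m n : ℕ} {x : X} {ε : ℝ}
    (h : E ⊆ bowenBall T m x ε) (hn : n ≤ m) (t : ℝ) :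
    bowenSum T E t n ε ≤ ENNReal.ofReal ((2 : ℝ) ^ (-t * (m : ℝ))) := by
  refine (iInf₂_le ({(x, m)} : Set (X × ℕ)) ⟨countable_singleton _, by simpa using hn,
    by simpa using h⟩).trans ?_
  rw [tsum_singleton (x, m) fun p : X × ℕ => ENNReal.ofReal ((2 : ℝ) ^ (-t * (p.2 : ℝ)))]

lemma bowenSum_iUnion_le {ι : Type*} [Countable ι] (E : ι → Set X) (t : ℝ) (n : ℕ) (ε : ℝ) :
    bowenSum T (⋃ i, E i) t n ε ≤ ∑' i, bowenSum T (E i) t n ε := by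
  refine ENNReal.le_of_forall_pos_le_add fun δ hδ hfin => ?_
  obtain ⟨δ', hδ', hsum⟩ := ENNReal.exists_pos_sum_of_countable
    (ENNReal.coe_pos.2 hδ).ne' ι
  have h : ∀ i, ∃ C ∈ bowenCovers T (E i) n ε,
      ∑' p : C, ENNReal.ofReal ((2 : ℝ) ^ (-t * (p.1.2 : ℝ))) <
        bowenSum T (E i) t n ε + δ' i := by
    intro i
    have hlt : bowenSum T (E i) t n ε < bowenSum T (E i) t n ε + δ' i :=
      ENNReal.lt_add_right (ne_top_of_le_ne_top hfin.ne (ENNReal.le_tsum i))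
        (ENNReal.coe_pos.2 (hδ' i)).ne'
    simpa only [bowenSum, iInf_lt_iff, exists_prop] using hlt
  choose C hC hCs using h
  have hmem : (⋃ i, C i) ∈ bowenCovers T (⋃ i, E i) n ε := by
    refine ⟨countable_iUnion fun i => (hC i).1, fun p hp => ?_, iUnion_subset fun i => ?_⟩
    · obtain ⟨i, hi⟩ := mem_iUnion.1 hp
      exact (hC i).2.1 p hi
    · exact (hC i).2.2.trans (biUnion_subset_biUnion_left (subset_iUnion C i))
  calc bowenSum T (⋃ i, E i) t n ε
      ≤ ∑' p : (⋃ i, C i : Set (X × ℕ)), ENNReal.ofReal ((2 : ℝ) ^ (-t * (p.1.2 : ℝ))) :=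
        iInf₂_le _ hmem
    _ ≤ ∑' i, ∑' p : C i, ENNReal.ofReal ((2 : ℝ) ^ (-t * (p.1.2 : ℝ))) :=
        ENNReal.tsum_iUnion_le_tsum
          (fun p : X × ℕ => ENNReal.ofReal ((2 : ℝ) ^ (-t * (p.2 : ℝ)))) C
    _ ≤ ∑' i, (bowenSum T (E i) t n ε + δ' i) := ENNReal.tsum_le_tsum fun i => (hCs i).le
    _ = ∑' i, bowenSum T (E i) t n ε + ∑' i, (δ' i : ℝ≥0∞) := ENNReal.tsum_add
    _ ≤ _ := by gcongr

lemma bowenMeasure_iUnion_eq_zero {ι : Type*} [Countable ι] {E : ι → Set X} {t ε : ℝ}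
    (h : ∀ i, bowenMeasure T (E i) t ε = 0) : bowenMeasure T (⋃ i, E i) t ε = 0 := by
  simp only [bowenMeasure, ENNReal.iSup_eq_zero] at h ⊢
  intro n
  refine le_antisymm ((bowenSum_iUnion_le E t n ε).trans ?_) zero_le
  simp [h]

lemma bowenMeasure_mono {E F : Set X} (h : E ⊆ F) (t ε : ℝ) :
    bowenMeasure T E t ε ≤ bowenMeasure T F t ε :=
  iSup_mono fun n => bowenSum_mono h t n ε

lemma topEntropy_mono {E F : Set X} (h : E ⊆ F) : topEntropy T E ≤ topEntropy T F := by
  refine iSup₂_mono fun ε _ => iInf_mono fun t => iInf_mono' fun ht => ⟨?_, le_rfl⟩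
  exact le_antisymm ((bowenMeasure_mono h t ε).trans ht.le) zero_le

/-- The set of points whose `ξ`-names have, along infinitely many initial segments, mean code
length at most `c` is `s`-null for `s > c`. -/
lemma bowenMeasure_codeLength_eq_zero {k N : ℕ} {ξ : X → Fin k} {ε : ℝ}
    (hξ : ∀ x y, ξ x = ξ y → dist x y ≤ ε) (G : (Fin (N + 1) → Fin k) → ℝ) (hG0 : ∀ v, 0 < G v)
    (hG : ∀ w : Fin N → Fin k, ∑ b, G (Fin.snoc w b) ≤ 1) {c s : ℝ} (hs0 : 0 ≤ s) (hs : c < s) :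
    bowenMeasure T {x | ∃ᶠ m : ℕ in atTop, ∑ i : Fin m,
      -Real.logb 2 (G (fun j => ξ (T^[(i : ℕ) + j] x))) ≤ m * c} s ε = 0 := by
  set S : (m : ℕ) → Set X := fun m => {x | ∑ i : Fin m,
      -Real.logb 2 (G (fun j => ξ (T^[(i : ℕ) + j] x))) ≤ m * c}
  set r : ℝ := (2 : ℝ) ^ (c - s) with hr
  have hr0 : 0 < r := by positivity
  have hr1 : r < 1 := Real.rpow_lt_one_of_one_lt_of_neg (by norm_num) (by linarith)
  have hSm : ∀ n m : ℕ, n ≤ m →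
      bowenSum T (S m) s n ε ≤ ENNReal.ofReal ((k : ℝ) ^ N * r ^ m) := by
    intro n m hnm
    have hcov : S m ⊆ ⋃ a : Fin (N + m) → Fin k,
        {x | x ∈ S m ∧ ∀ l : Fin (N + m), ξ (T^[l] x) = a l} := fun x hx =>
      mem_iUnion.2 ⟨fun l => ξ (T^[l] x), hx, fun _ => rfl⟩
    refine ((bowenSum_mono hcov s n ε).trans (bowenSum_iUnion_le _ s n ε)).trans ?_
    -- Points sharing a name of length `N + m` lie in one dynamical ball, of weight `2^(-s(N+m)) ≤
    -- r^m * 2^(-mc)`. Membership in `S m` says that `2^(-mc)` is at most the product of `G` along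
    -- the word, and these products are summable by the Kraft inequality.
    have hterm : ∀ a : Fin (N + m) → Fin k,
        bowenSum T {x | x ∈ S m ∧ ∀ l : Fin (N + m), ξ (T^[l] x) = a l} s n ε ≤
        ENNReal.ofReal (r ^ m * ∏ i : Fin m, G (fun j => a ⟨i + j, by omega⟩)) := by
      intro a
      rcases eq_empty_or_nonempty {x | x ∈ S m ∧ ∀ l : Fin (N + m), ξ (T^[l] x) = a l}
        with he | ⟨x, hxS, hx⟩
      · rw [he, bowenSum_empty]; exact zero_le
      · refine (bowenSum_le_of_subset_bowenBall (m := N + m) (x := x) ?_ (by omega) s).trans ?_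
        · rintro y ⟨-, hy⟩ j hj
          exact hξ _ _ ((hx ⟨j, hj⟩).trans (hy ⟨j, hj⟩).symm)
        · apply ENNReal.ofReal_le_ofReal
          have hlen : -(m * c) ≤ Real.logb 2 (∏ i : Fin m, G (fun j => a ⟨i + j, by omega⟩)) := by
            rw [Real.logb_prod _ _ fun i _ => (hG0 _).ne']
            have h1 : ∑ i : Fin m, -Real.logb 2 (G (fun j => ξ (T^[(i : ℕ) + j] x))) ≤ m * c := hxS
            have h2 : ∀ i : Fin m, (fun j : Fin (N + 1) => ξ (T^[(i : ℕ) + j] x)) =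
                fun j : Fin (N + 1) => a ⟨i + j, by omega⟩ :=
              fun i => funext fun j => hx ⟨i + j, by omega⟩
            simp only [h2, Finset.sum_neg_distrib] at h1
            linarith
          have hP : 0 < ∏ i : Fin m, G (fun j => a ⟨i + j, by omega⟩) :=
            Finset.prod_pos fun i _ => hG0 _
          have h3 : (2 : ℝ) ^ (-(m * c)) ≤ ∏ i : Fin m, G (fun j => a ⟨i + j, by omega⟩) :=
            (Real.le_logb_iff_rpow_le (by norm_num) hP).1 hlen
          calc (2 : ℝ) ^ (-s * ((N + m : ℕ) : ℝ)) ≤ (2 : ℝ) ^ ((c - s) * m + -(m * c)) := by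
                apply Real.rpow_le_rpow_of_exponent_le (by norm_num)
                push_cast
                have : 0 ≤ s * N := by positivity
                nlinarith
            _ = r ^ m * (2 : ℝ) ^ (-(m * c)) := by
                rw [Real.rpow_add (by norm_num), Real.rpow_mul_natCast (by norm_num)]
            _ ≤ _ := by gcongr
    rw [tsum_fintype]
    refine (Finset.sum_le_sum fun a _ => hterm a).trans ?_
    rw [← ENNReal.ofReal_sum_of_nonneg fun a _ => mul_nonneg (by positivity)
      (Finset.prod_nonneg fun i _ => (hG0 _).le), ← Finset.mul_sum, mul_comm]
    apply ENNReal.ofReal_le_ofReal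
    gcongr
    exact sum_prod_window_le G (fun v => (hG0 v).le) hG m
  -- Borel–Cantelli: the limsup set lies in the union of the `S m` with `m ≥ n`, whose costs form a
  -- geometric tail.
  have hn : ∀ n : ℕ, bowenSum T {x | ∃ᶠ m : ℕ in atTop, x ∈ S m} s n ε ≤
      ENNReal.ofReal ((k : ℝ) ^ N) * (1 - ENNReal.ofReal r)⁻¹ * ENNReal.ofReal r ^ n := by
    intro n
    have hcov : {x | ∃ᶠ m : ℕ in atTop, x ∈ S m} ⊆ ⋃ i : ℕ, S (n + i) := fun x hx => by
      obtain ⟨m, hm, hxm⟩ := frequently_atTop.1 hx n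
      exact mem_iUnion.2 ⟨m - n, by rwa [Nat.add_sub_cancel' hm]⟩
    calc _ ≤ ∑' i : ℕ, bowenSum T (S (n + i)) s n ε :=
          (bowenSum_mono hcov s n ε).trans (bowenSum_iUnion_le _ s n ε)
      _ ≤ ∑' i : ℕ, ENNReal.ofReal ((k : ℝ) ^ N) * ENNReal.ofReal r ^ n * ENNReal.ofReal r ^ i := by
          refine ENNReal.tsum_le_tsum fun i => (hSm n (n + i) (by omega)).trans_eq ?_
          rw [ENNReal.ofReal_mul (by positivity), ENNReal.ofReal_pow hr0.le, pow_add, mul_assoc]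
      _ = _ := by rw [ENNReal.tsum_mul_left, ENNReal.tsum_geometric]; ring
  have hr1' : ENNReal.ofReal r < 1 := by simpa using hr1
  have hlim : Tendsto (fun n : ℕ => ENNReal.ofReal ((k : ℝ) ^ N) * (1 - ENNReal.ofReal r)⁻¹ *
      ENNReal.ofReal r ^ n) atTop (𝓝 0) := by
    have := ENNReal.Tendsto.const_mul (a := ENNReal.ofReal ((k : ℝ) ^ N) * (1 - ENNReal.ofReal r)⁻¹)
      (ENNReal.tendsto_pow_atTop_nhds_zero_of_lt_one hr1')
      (Or.inr (ENNReal.mul_ne_top ENNReal.ofReal_ne_top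
        (ENNReal.inv_ne_top.2 (tsub_pos_of_lt hr1').ne')))
    simpa using this
  simp only [bowenMeasure, ENNReal.iSup_eq_zero]
  intro n
  refine le_antisymm (ge_of_tendsto hlim ?_) zero_le
  filter_upwards [eventually_ge_atTop n] with n' hn'
  exact (bowenSum_mono_nat _ s hn' ε).trans (hn n')

end BowenSum

end TopDyn

namespace TopDyn

/-! ### Cells of refined partitions and entropy increments -/

section WordCells

variable {X : Type*}

/-- The set of points whose `ξ`-name begins with the word `w`. -/
def wordCell (T : X → X) {k n : ℕ} (ξ : X → Fin k) (w : Fin n → Fin k) : Set X :=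
  {x | ∀ i : Fin n, ξ (T^[i] x) = w i}

variable {T : X → X} {k : ℕ} {ξ : X → Fin k}

lemma mem_wordCell_iff {n : ℕ} {w : Fin n → Fin k} {x : X} :
    x ∈ wordCell T ξ w ↔ (fun i : Fin n => ξ (T^[i] x)) = w :=
  funext_iff.symm

lemma wordCell_eq_iInter {n : ℕ} (w : Fin n → Fin k) :
    wordCell T ξ w = ⋂ i : Fin n, T^[i] ⁻¹' (ξ ⁻¹' {w i}) := by
  ext x
  simp [wordCell]

lemma partitionEntropy_eq [MeasurableSpace X] (μ : Measure X) (n : ℕ) :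
    partitionEntropy T μ ξ n =
      -∑ w : Fin n → Fin k, μ.real (wordCell T ξ w) * Real.logb 2 (μ.real (wordCell T ξ w)) :=
  rfl

lemma measurableSet_wordCell [MeasurableSpace X] (hT : Measurable T) (hξ : Measurable ξ) {n : ℕ}
    (w : Fin n → Fin k) : MeasurableSet (wordCell T ξ w) := by
  rw [wordCell_eq_iInter]
  exact MeasurableSet.iInter fun i => (hT.iterate i) (hξ (measurableSet_singleton _))

lemma measureReal_wordCell_eq_sum [MeasurableSpace X] (hT : Measurable T) (hξ : Measurable ξ)
    (μ : Measure X) [IsFiniteMeasure μ] {n : ℕ} (w : Fin n → Fin k) :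
    μ.real (wordCell T ξ w) = ∑ b, μ.real (wordCell T ξ (Fin.snoc w b : Fin (n + 1) → Fin k)) := by
  rw [← measureReal_iUnion_fintype]
  · congr 1
    ext x
    simp only [wordCell, mem_iUnion, mem_ofPred_eq, Fin.forall_fin_succ', Fin.snoc_castSucc,
      Fin.snoc_last, Fin.val_castSucc, Fin.val_last]
    exact ⟨fun h => ⟨_, h, rfl⟩, fun ⟨_, h, _⟩ => h⟩
  · intro b b' hb
    refine Set.disjoint_left.2 fun x hx hx' => hb ?_
    have h1 := hx (Fin.last n)
    have h2 := hx' (Fin.last n)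
    simp only [Fin.snoc_last] at h1 h2
    exact h1.symm.trans h2
  · exact fun b => measurableSet_wordCell hT hξ _

lemma partitionEntropy_zero [MeasurableSpace X] (μ : Measure X) [IsProbabilityMeasure μ] :
    partitionEntropy T μ ξ 0 = 0 := by
  have h : ∀ w : Fin 0 → Fin k, wordCell T ξ w = univ := fun w => by simp [wordCell_eq_iInter]
  simp [partitionEntropy_eq, h]

/-- If the entropy of a partition is below `c`, then so is one of the increments of the entropies
of its refinements. -/
lemma exists_partitionEntropy_sub_lt [MeasurableSpace X] (μ : Measure X) [IsProbabilityMeasure μ]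
    {c : ℝ≥0} (h : entropyOfPartition T μ ξ < c) :
    ∃ n, partitionEntropy T μ ξ (n + 1) - partitionEntropy T μ ξ n < c := by
  by_contra! hc
  -- If every increment were at least `c`, telescoping from `H_0 = 0` would give `H_n ≥ n c`, hence
  -- entropy at least `c`.
  have hn : ∀ n : ℕ, n * (c : ℝ) ≤ partitionEntropy T μ ξ n := by
    intro n
    induction n with
    | zero => simp [partitionEntropy_zero]
    | succ n ih => push_cast; linarith [hc n]
  refine h.not_ge (le_limsup_of_frequently_le (Eventually.frequently ?_))
  filter_upwards [eventually_gt_atTop 0] with n hn0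
  have hn0' : (0 : ℝ) < n := by exact_mod_cast hn0
  rw [ENNReal.le_ofReal_iff_toReal_le ENNReal.coe_ne_top
    (div_nonneg (le_trans (by positivity) (hn n)) hn0'.le), ENNReal.coe_toReal, le_div_iff₀ hn0',
    mul_comm]
  exact hn n

lemma entropyOfPartition_le_metricEntropy [MeasurableSpace X] (μ : Measure X)
    (hξ : Measurable ξ) : entropyOfPartition T μ ξ ≤ metricEntropy T μ :=
  le_iSup_of_le k (le_iSup₂ (f := fun (ξ : X → Fin k) (_ : Measurable ξ) =>
    entropyOfPartition T μ ξ) ξ hξ)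

end WordCells

/-! ### Fine partitions with null boundaries -/

section NullBoundary

variable {X : Type*}

lemma measure_frontier_iInter_eq_zero [TopologicalSpace X] [MeasurableSpace X] {μ : Measure X}
    {ι : Type*} [Finite ι] {s : ι → Set X} (h : ∀ i, μ (frontier (s i)) = 0) :
    μ (frontier (⋂ i, s i)) = 0 := by
  refine measure_mono_null (fun x hx => ?_) (measure_iUnion_null h)
  rw [frontier, interior_iInter_of_finite, Set.mem_sdiff, mem_iInter, not_forall] at hx
  obtain ⟨hx, i, hi⟩ := hx
  exact mem_iUnion.2 ⟨i, closure_mono (iInter_subset s i) hx, hi⟩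

lemma measure_frontier_wordCell_eq_zero [TopologicalSpace X] [MeasurableSpace X] {μ : Measure X}
    {T : X → X} (hT : Continuous T) (hμ : MeasurePreserving T μ μ) {k : ℕ} {ξ : X → Fin k}
    [OpensMeasurableSpace X] (hξ : ∀ b, μ (frontier (ξ ⁻¹' {b})) = 0) {n : ℕ} (w : Fin n → Fin k) :
    μ (frontier (wordCell T ξ w)) = 0 := by
  rw [wordCell_eq_iInter]
  refine measure_frontier_iInter_eq_zero fun i => ?_
  refine measure_mono_null ((hT.iterate i).frontier_preimage_subset _) ?_
  rw [(hμ.iterate i).measure_preimage isClosed_frontier.measurableSet.nullMeasurableSet]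
  exact hξ _

/-- A compact metric space has finite measurable partitions of arbitrarily small mesh whose cells
have null boundaries. -/
lemma exists_partition_null_frontier [MetricSpace X] [CompactSpace X] [MeasurableSpace X]
    [BorelSpace X] (μ : Measure X) [IsFiniteMeasure μ] {ε : ℝ} (hε : 0 < ε) :
    ∃ (k : ℕ) (ξ : X → Fin k), Measurable ξ ∧ (∀ x y, ξ x = ξ y → dist x y ≤ ε) ∧
      ∀ b, μ (frontier (ξ ⁻¹' {b})) = 0 := by
  classical
  choose r hr hrμ using fun x : X =>
    exists_null_frontier_thickening μ {x} (show (0 : ℝ) < ε / 2 by positivity)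
  simp only [Metric.thickening_singleton] at hrμ
  obtain ⟨t, ht⟩ := CompactSpace.elim_nhds_subcover (fun x => Metric.ball x (r x))
    fun x => Metric.ball_mem_nhds x (hr x).1
  -- Cells are the membership patterns in the balls of a finite cover. Points with the same pattern
  -- share a ball of radius below `ε / 2`.
  let f : X → (t → Bool) := fun x i => decide (x ∈ Metric.ball (i : X) (r i))
  have hf : ∀ S : t → Bool, f ⁻¹' {S} =
      ⋂ i : t, if S i then Metric.ball (i : X) (r i) else (Metric.ball (i : X) (r i))ᶜ := by
    intro S
    ext x
    simp only [mem_preimage, mem_singleton_iff, funext_iff, mem_iInter, f]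
    refine forall_congr' fun i => ?_
    cases S i <;> simp
  let e := Fintype.equivFin (t → Bool)
  have he : ∀ b, (fun x => e (f x)) ⁻¹' {b} = f ⁻¹' {e.symm b} := by
    intro b
    ext x
    simp [Equiv.eq_symm_apply]
  refine ⟨_, fun x => e (f x), measurable_to_countable' fun b => ?_, fun x y hxy => ?_,
    fun b => ?_⟩
  · rw [he, hf]
    refine MeasurableSet.iInter fun i => ?_
    split_ifs
    · exact measurableSet_ball
    · exact measurableSet_ball.compl
  · have hfxy : f x = f y := e.injective hxy
    obtain ⟨z, hz, hxz⟩ := mem_iUnion₂.1 (ht.ge (mem_univ x))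
    have hyz : y ∈ Metric.ball z (r z) := by
      have := congrFun hfxy ⟨z, hz⟩
      simp only [f, decide_eq_decide] at this
      exact this.1 hxz
    rw [Metric.mem_ball] at hxz hyz
    linarith [dist_triangle_right x y z, (hr z).2]
  · rw [he, hf]
    refine measure_frontier_iInter_eq_zero fun i => ?_
    split_ifs
    · exact hrμ _
    · rw [frontier_compl]; exact hrμ _

end NullBoundary

/-! ### Empirical measures and Bowen's theorem -/

section Empirical

variable {X : Type*} [MetricSpace X] [MeasurableSpace X] [BorelSpace X] {T : X → X}

lemma integral_empiricalMeasure (x : X) (n : ℕ) (f : X → ℝ) :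
    ∫ y, f y ∂(empiricalMeasure T x n : Measure X) =
      ((n + 1 : ℕ) : ℝ)⁻¹ * ∑ i ∈ Finset.range (n + 1), f (T^[i] x) := by
  have hd : ∀ y : X, Integrable f (Measure.dirac y) := fun y => integrable_dirac (by simp)
  change ∫ y, f y ∂(((n + 1 : ℕ) : ℝ≥0∞)⁻¹ •
    ∑ i ∈ Finset.range (n + 1), Measure.dirac (T^[i] x)) = _
  rw [integral_smul_measure, integral_finsetSum_measure fun i _ => hd _]
  rw [ENNReal.toReal_inv, ENNReal.toReal_natCast, smul_eq_mul]
  simp only [integral_dirac]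

lemma measureReal_empiricalMeasure (x : X) (n : ℕ) {s : Set X} (hs : MeasurableSet s) :
    (empiricalMeasure T x n : Measure X).real s =
      ((n + 1 : ℕ) : ℝ)⁻¹ * ∑ i ∈ Finset.range (n + 1), s.indicator 1 (T^[i] x) := by
  rw [← integral_empiricalMeasure, integral_indicator_one hs]

/-- The weak limits of empirical measures are invariant. -/
lemma measurePreserving_of_tendsto_empiricalMeasure (hT : Continuous T) {x : X} {φ : ℕ → ℕ}
    (hφ : StrictMono φ) {μ : ProbabilityMeasure X}
    (h : Tendsto (fun j => empiricalMeasure T x (φ j)) atTop (𝓝 μ)) :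
    MeasurePreserving T (μ : Measure X) (μ : Measure X) := by
  have h1 := ProbabilityMeasure.tendsto_map_of_tendsto_of_continuous _ _ h hT
  have h2 : Tendsto (fun j => (empiricalMeasure T x (φ j)).map hT.measurable.aemeasurable) atTop
      (𝓝 μ) := by
    rw [ProbabilityMeasure.tendsto_iff_forall_integral_tendsto] at h ⊢
    intro f
    -- Pushing forward shifts the orbit segment by one step, so the two integrals differ only by the
    -- telescoped end terms, which are `O(1/n)`.
    have hdiff : ∀ n : ℕ, ∫ y, f y ∂((empiricalMeasure T x n).map hT.measurable.aemeasurable :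
        Measure X) - ∫ y, f y ∂(empiricalMeasure T x n : Measure X) =
        ((n + 1 : ℕ) : ℝ)⁻¹ * (f (T^[n + 1] x) - f x) := by
      intro n
      rw [ProbabilityMeasure.toMeasure_map, integral_map hT.measurable.aemeasurable
        f.continuous.measurable.aestronglyMeasurable, integral_empiricalMeasure,
        integral_empiricalMeasure, ← mul_sub, ← Finset.sum_sub_distrib]
      have := Finset.sum_range_sub (fun i => f (T^[i] x)) (n + 1)
      simp only [Function.iterate_succ_apply', Function.iterate_zero, id] at this ⊢
      rw [this]
    have hlim : Tendsto (fun n : ℕ => ((n + 1 : ℕ) : ℝ)⁻¹ * (f (T^[n + 1] x) - f x)) atTop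
        (𝓝 0) := by
      refine (((tendsto_add_atTop_iff_nat 1).2
        tendsto_inv_atTop_nhds_zero_nat).zero_mul_isBoundedUnder_le ?_)
      refine isBoundedUnder_of ⟨2 * ‖f‖, fun n => ?_⟩
      simp only [Function.comp]
      calc ‖f (T^[n + 1] x) - f x‖ ≤ ‖f (T^[n + 1] x)‖ + ‖f x‖ := norm_sub_le _ _
        _ ≤ 2 * ‖f‖ := by linarith [f.norm_coe_le_norm (T^[n + 1] x), f.norm_coe_le_norm x]
    have := (h f).add (hlim.comp hφ.tendsto_atTop)
    rw [add_zero] at this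
    refine this.congr fun j => ?_
    simp only [Function.comp, ← hdiff]
    ring
  have h3 := tendsto_nhds_unique h1 h2
  exact ⟨hT.measurable, congrArg Subtype.val h3⟩

variable [CompactSpace X]

lemma limitMeasures_nonempty (hT : Continuous T) (x : X) : (limitMeasures T x).Nonempty := by
  let := TopologicalSpace.pseudoMetrizableSpacePseudoMetric (ProbabilityMeasure X)
  obtain ⟨μ, -, φ, hφ, h⟩ := isCompact_univ.tendsto_subseq
    (fun n => mem_univ (empiricalMeasure T x n))
  exact ⟨⟨μ, measurePreserving_of_tendsto_empiricalMeasure hT hφ h⟩, φ, hφ, h⟩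

/-- Invariance is the closed condition that pushforward fixes the measure, inside the compact space
of probability measures. -/
lemma compactSpace_invMeasure (hT : Continuous T) : CompactSpace (InvMeasure T) := by
  refine isCompact_iff_compactSpace.1 (IsClosed.isCompact ?_)
  have : {μ : ProbabilityMeasure X | MeasurePreserving T (μ : Measure X) (μ : Measure X)} =
      {μ | μ.map hT.measurable.aemeasurable = μ} := by
    ext μ
    exact ⟨fun h => Subtype.ext h.map_eq, fun h => ⟨hT.measurable, congrArg Subtype.val h⟩⟩
  change IsClosed {μ : ProbabilityMeasure X | MeasurePreserving T (μ : Measure X) (μ : Measure X)}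
  rw [this]
  exact isClosed_eq (ProbabilityMeasure.continuous_map hT) continuous_id

/-- An invariant measure of entropy less than `s` has a neighbourhood such that the points whose
empirical measures enter it infinitely often form an `s`-null set. -/
lemma exists_nhds_bowenMeasure_eq_zero (hT : Continuous T) (μ : InvMeasure T) {s : ℝ≥0}
    (hs : metricEntropy T μ.meas < s) {ε : ℝ} (hε : 0 < ε) :
    ∃ U ∈ 𝓝 μ.1, bowenMeasure T {x | ∃ᶠ n in atTop, empiricalMeasure T x n ∈ U} s ε = 0 := by
  obtain ⟨k, ξ, hξ, hdist, hfr⟩ := exists_partition_null_frontier μ.meas hε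
  obtain ⟨c, hc, hcs⟩ := ENNReal.lt_iff_exists_nnreal_btwn.1 hs
  have hξc : entropyOfPartition T μ.meas ξ < c :=
    lt_of_le_of_lt (entropyOfPartition_le_metricEntropy μ.meas hξ) hc
  obtain ⟨N, hN⟩ := exists_partitionEntropy_sub_lt μ.meas hξc
  obtain ⟨G, hG0, hG1, hG⟩ := exists_pos_kernel (k := k) (N := N)
    (fun v => μ.meas.real (wordCell T ξ v)) (fun _ => measureReal_nonneg)
    (fun w => μ.meas.real (wordCell T ξ w))
    (fun w => measureReal_wordCell_eq_sum hT.measurable hξ μ.meas w) (c := c)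
    (by rw [partitionEntropy_eq, partitionEntropy_eq] at hN; linarith)
  -- The mean code length is a finite combination of masses of cells with `μ`-null boundary, so the
  -- portmanteau theorem gives continuity at `μ`.
  have hcont : ContinuousAt (fun ν : ProbabilityMeasure X => ∑ v : Fin (N + 1) → Fin k,
      (ν : Measure X).real (wordCell T ξ v) * (-Real.logb 2 (G v))) μ.1 := by
    refine tendsto_finsetSum _ fun v _ => Tendsto.mul_const _ ?_
    refine (ENNReal.tendsto_toReal (measure_ne_top _ _)).comp
      (ProbabilityMeasure.tendsto_measure_of_null_frontier_of_tendsto' tendsto_id ?_)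
    exact measure_frontier_wordCell_eq_zero hT μ.2 hfr v
  refine ⟨_, hcont.eventually_lt_const hG, ?_⟩
  have hnull := bowenMeasure_codeLength_eq_zero (T := T) hdist G hG0 hG1 s.2
    (show (c : ℝ) < s by exact_mod_cast hcs)
  refine le_antisymm ((bowenMeasure_mono (fun x hx => ?_) _ _).trans hnull.le) zero_le
  -- The index `n` of an empirical measure stands for `n + 1` orbit points, so the code-length sum
  -- has `m = n + 1` windows.
  refine (tendsto_add_atTop_nat 1).frequently (Frequently.mono hx fun n hn => ?_)
  have hn : ∑ v : Fin (N + 1) → Fin k,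
      (empiricalMeasure T x n : Measure X).real (wordCell T ξ v) * (-Real.logb 2 (G v)) < c := hn
  have hsum : ∑ v : Fin (N + 1) → Fin k,
      (empiricalMeasure T x n : Measure X).real (wordCell T ξ v) * (-Real.logb 2 (G v)) =
      ((n + 1 : ℕ) : ℝ)⁻¹ * ∑ i : Fin (n + 1),
        -Real.logb 2 (G (fun j => ξ (T^[(i : ℕ) + j] x))) := by
    classical
    simp only [measureReal_empiricalMeasure x n (measurableSet_wordCell hT.measurable hξ _),
      mul_assoc]
    rw [← Finset.mul_sum]
    congr 1
    simp only [Finset.sum_mul]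
    rw [Finset.sum_comm, Finset.sum_range]
    refine Finset.sum_congr rfl fun i _ => ?_
    have hw : ∀ v : Fin (N + 1) → Fin k, (wordCell T ξ v).indicator (1 : X → ℝ) (T^[i] x) =
        if (fun j : Fin (N + 1) => ξ (T^[(i : ℕ) + j] x)) = v then 1 else 0 := by
      intro v
      simp only [indicator_apply, mem_wordCell_iff, ← Function.iterate_add_apply, Pi.one_apply,
        add_comm (i : ℕ)]
    simp [hw]
  rw [hsum, inv_mul_lt_iff₀ (by positivity)] at hn
  exact hn.le

/-- **Bowen's theorem**: if every point of `E` has a limit measure of entropy at most `t`, then the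
topological entropy of `E` is at most `t`. -/
theorem topEntropy_le_of_forall_exists_limitMeasures (hT : Continuous T) {E : Set X} {t : ℝ≥0∞}
    (h : ∀ x ∈ E, ∃ μ ∈ limitMeasures T x, metricEntropy T μ.meas ≤ t) : topEntropy T E ≤ t := by
  refine iSup₂_le fun ε hε => le_of_forall_gt_imp_ge_of_dense fun s' hs' => ?_
  obtain ⟨s, hs, hss'⟩ := ENNReal.lt_iff_exists_nnreal_btwn.1 hs'
  refine (iInf₂_le s ?_).trans hss'.le
  choose! U hU hU0 using fun (μ : InvMeasure T) (hμ : metricEntropy T μ.meas < s) =>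
    exists_nhds_bowenMeasure_eq_zero hT μ hμ hε
  let := TopologicalSpace.pseudoMetrizableSpacePseudoMetric (ProbabilityMeasure X)
  have : SecondCountableTopology (ProbabilityMeasure X) :=
    EMetric.secondCountable_of_sigmaCompact _
  -- Lindelöf: countably many of the neighbourhoods cover all measures of entropy below `s`, which
  -- is what countable subadditivity can handle.
  obtain ⟨M, hM, hMc, hcov⟩ := TopologicalSpace.countable_cover_nhdsWithin
    (f := fun μ : InvMeasure T => Subtype.val ⁻¹' interior (U μ)) (s := {μ | metricEntropy T μ.meas < s})
    fun μ hμ => mem_nhdsWithin_of_mem_nhds (continuous_subtype_val.continuousAt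
      (interior_mem_nhds.2 (hU μ hμ)))
  have hE : E ⊆ ⋃ μ : M, {x | ∃ᶠ n in atTop, empiricalMeasure T x n ∈ U μ.1} := by
    intro x hx
    obtain ⟨μ, ⟨φ, hφ, hlim⟩, hμt⟩ := h x hx
    obtain ⟨ν, hν, hμν⟩ := mem_iUnion₂.1 (hcov (show metricEntropy T μ.meas < s from
      hμt.trans_lt hs))
    refine mem_iUnion.2 ⟨⟨ν, hν⟩, hφ.tendsto_atTop.frequently (Eventually.frequently ?_)⟩
    exact hlim (mem_interior_iff_mem_nhds.1 hμν)
  have : Countable M := hMc.to_subtype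
  exact le_antisymm ((bowenMeasure_mono hE s ε).trans
    (bowenMeasure_iUnion_eq_zero fun μ : M => hU0 μ.1 (hM μ.2)).le) zero_le

end Empirical

end TopDyn

namespace TopDyn

/-! ### Concavity of entropy and segments of measures -/

section Mix

variable {X : Type*} [MeasurableSpace X]

lemma partitionEntropy_eq_sum_negMulLog (T : X → X) (μ : Measure X) {k : ℕ} (ξ : X → Fin k)
    (n : ℕ) : partitionEntropy T μ ξ n =
      (∑ w : Fin n → Fin k, Real.negMulLog (μ.real (wordCell T ξ w))) / Real.log 2 := by
  rw [partitionEntropy_eq, Finset.sum_div, ← Finset.sum_neg_distrib]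
  refine Finset.sum_congr rfl fun w _ => ?_
  rw [Real.negMulLog, Real.logb]
  ring

lemma partitionEntropy_nonneg (T : X → X) (μ : Measure X) [IsProbabilityMeasure μ] {k : ℕ}
    (ξ : X → Fin k) (n : ℕ) : 0 ≤ partitionEntropy T μ ξ n := by
  rw [partitionEntropy_eq_sum_negMulLog]
  exact div_nonneg (Finset.sum_nonneg fun w _ =>
    Real.negMulLog_nonneg measureReal_nonneg measureReal_le_one) (Real.log_nonneg (by norm_num))

variable {T : X → X}

lemma measureReal_mix (θ : I) (μ ν : InvMeasure T) (s : Set X) :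
    (InvMeasure.mix θ μ ν).meas.real s = θ * μ.meas.real s + (1 - θ) * ν.meas.real s := by
  change (ENNReal.ofReal (θ : ℝ) • μ.meas + ENNReal.ofReal (1 - (θ : ℝ)) • ν.meas).real s = _
  rw [measureReal_add_apply
    (ENNReal.mul_ne_top ENNReal.ofReal_ne_top (measure_ne_top _ _))
    (ENNReal.mul_ne_top ENNReal.ofReal_ne_top (measure_ne_top _ _)), measureReal_ennreal_smul_apply,
    measureReal_ennreal_smul_apply, ENNReal.toReal_ofReal θ.2.1,
    ENNReal.toReal_ofReal (sub_nonneg.2 θ.2.2)]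

/-- Concavity of `-x log x` on each cell; the nonnegative contribution of `ν` is then dropped. -/
lemma mul_partitionEntropy_le_mix (θ : I) (μ ν : InvMeasure T) {k : ℕ} (ξ : X → Fin k) (n : ℕ) :
    θ * partitionEntropy T μ.meas ξ n ≤
      partitionEntropy T (InvMeasure.mix θ μ ν).meas ξ n := by
  have hν := mul_nonneg (sub_nonneg.2 θ.2.2) (partitionEntropy_nonneg T ν.meas ξ n)
  suffices h : θ * partitionEntropy T μ.meas ξ n + (1 - θ) * partitionEntropy T ν.meas ξ n ≤
      partitionEntropy T (InvMeasure.mix θ μ ν).meas ξ n by linarith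
  simp only [partitionEntropy_eq_sum_negMulLog, ← mul_div_assoc, ← add_div, Finset.mul_sum,
    ← Finset.sum_add_distrib]
  refine div_le_div_of_nonneg_right (Finset.sum_le_sum fun w _ => ?_)
    (Real.log_nonneg (by norm_num))
  rw [measureReal_mix]
  exact Real.concaveOn_negMulLog.2 (mem_Ici.2 measureReal_nonneg) (mem_Ici.2 measureReal_nonneg)
    θ.2.1 (sub_nonneg.2 θ.2.2) (by ring)

lemma mul_metricEntropy_le_mix (θ : I) (μ ν : InvMeasure T) :
    ENNReal.ofReal θ * metricEntropy T μ.meas ≤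
      metricEntropy T (InvMeasure.mix θ μ ν).meas := by
  simp only [metricEntropy, ENNReal.mul_iSup]
  refine iSup_mono fun k => iSup_mono fun ξ => iSup_mono fun _ => ?_
  rw [entropyOfPartition, ← ENNReal.limsup_const_mul_of_ne_top ENNReal.ofReal_ne_top]
  refine limsup_le_limsup (Eventually.of_forall fun n => ?_)
  beta_reduce
  rw [← ENNReal.ofReal_mul θ.2.1, ← mul_div_assoc]
  gcongr
  exact mul_partitionEntropy_le_mix θ μ ν ξ n

lemma mix_mem_convexSums (θ : I) (μ ν : InvMeasure T) :
    InvMeasure.mix θ μ ν ∈ convexSums ![μ, ν] := by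
  refine ⟨![Real.toNNReal θ, Real.toNNReal (1 - θ)], ?_, ?_⟩
  · rw [Fin.sum_univ_two, ← NNReal.coe_inj]
    simp [θ.2.1, θ.2.2]
  · rw [Fin.sum_univ_two]
    rfl

lemma continuous_mix [TopologicalSpace X] [OpensMeasurableSpace X] (μ ν : InvMeasure T) :
    Continuous fun θ : I => InvMeasure.mix θ μ ν := by
  refine Continuous.subtype_mk (f := fun θ : I => (InvMeasure.mix θ μ ν).1) ?_ _
  rw [ProbabilityMeasure.continuous_iff_forall_continuous_integral]
  intro f
  have h : ∀ θ : I, ∫ x, f x ∂(InvMeasure.mix θ μ ν).meas =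
      θ * ∫ x, f x ∂μ.meas + (1 - θ) * ∫ x, f x ∂ν.meas := by
    intro θ
    change ∫ x, f x ∂(ENNReal.ofReal (θ : ℝ) • μ.meas +
      ENNReal.ofReal (1 - (θ : ℝ)) • ν.meas) = _
    rw [integral_add_measure ((f.integrable μ.meas).smul_measure ENNReal.ofReal_ne_top)
      ((f.integrable ν.meas).smul_measure ENNReal.ofReal_ne_top), integral_smul_measure,
      integral_smul_measure, ENNReal.toReal_ofReal θ.2.1,
      ENNReal.toReal_ofReal (sub_nonneg.2 θ.2.2)]
    rfl
  refine Continuous.congr ?_ fun θ => (h θ).symm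
  fun_prop

end Mix

/-! ### Lower bounds from saturation -/

section Saturation

variable {X : Type*} [MetricSpace X] [CompactSpace X] [MeasurableSpace X] [BorelSpace X]
  {T : X → X} {α : InvMeasure T → ℝ}

lemma bddBelow_image_invMeasure (hT : Continuous T) (hα : Continuous α) (K : Set (InvMeasure T)) :
    BddBelow (α '' K) :=
  have := compactSpace_invMeasure hT
  (isCompact_range hα).bddBelow.mono (image_subset_range α K)

lemma bddAbove_image_invMeasure (hT : Continuous T) (hα : Continuous α) (K : Set (InvMeasure T)) :
    BddAbove (α '' K) :=
  have := compactSpace_invMeasure hT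
  (isCompact_range hα).bddAbove.mono (image_subset_range α K)

/-- Nonemptiness of `M_x` and compactness of `M(T,X)` make the real `sInf` and `sSup` genuine, so
their default values play no role. -/
lemma mem_irregularSet_iff (hT : Continuous T) (hα : Continuous α) {x : X} :
    x ∈ irregularSet α ↔ ∃ μ ∈ limitMeasures T x, ∃ ν ∈ limitMeasures T x, α μ ≠ α ν := by
  have hne : (α '' limitMeasures T x).Nonempty := (limitMeasures_nonempty hT x).image α
  constructor
  · intro h
    obtain ⟨_, ⟨ν, hν, rfl⟩, hlt⟩ := exists_lt_of_lt_csSup hne h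
    obtain ⟨_, ⟨μ, hμ, rfl⟩, hlt'⟩ := exists_lt_of_csInf_lt hne hlt
    exact ⟨μ, hμ, ν, hν, hlt'.ne⟩
  · rintro ⟨μ, hμ, ν, hν, hμν⟩
    have key : ∀ μ ∈ limitMeasures T x, ∀ ν ∈ limitMeasures T x, α μ < α ν →
        x ∈ irregularSet α := fun μ hμ ν hν h =>
      ((csInf_le (bddBelow_image_invMeasure hT hα _) (mem_image_of_mem α hμ)).trans_lt h).trans_le
        (le_csSup (bddAbove_image_invMeasure hT hα _) (mem_image_of_mem α hν))
    rcases hμν.lt_or_gt with h | h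
    · exact key μ hμ ν hν h
    · exact key ν hν μ hμ h

lemma mem_levelSet_iff (hT : Continuous T) (hα : Continuous α) {x : X} {a : ℝ} :
    x ∈ levelSet α a ↔ ∀ μ ∈ limitMeasures T x, α μ = a := by
  constructor
  · rintro ⟨h1, h2⟩ μ hμ
    exact le_antisymm
      (h2 ▸ le_csSup (bddAbove_image_invMeasure hT hα _) (mem_image_of_mem α hμ))
      (h1 ▸ csInf_le (bddBelow_image_invMeasure hT hα _) (mem_image_of_mem α hμ))
  · intro h
    have him : α '' limitMeasures T x = {a} :=
      ((limitMeasures_nonempty hT x).image α).subset_singleton_iff.1 (by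
        rintro _ ⟨μ, hμ, rfl⟩; exact h μ hμ)
    change sInf (α '' limitMeasures T x) = a ∧ sSup (α '' limitMeasures T x) = a
    simp [him]

/-- One half of the variational principle. -/
lemma topEntropy_univ_le (hT : Continuous T) :
    topEntropy T univ ≤ ⨆ μ : InvMeasure T, metricEntropy T μ.meas :=
  topEntropy_le_of_forall_exists_limitMeasures hT fun x _ =>
    let ⟨μ, hμ⟩ := limitMeasures_nonempty hT x
    ⟨μ, hμ, le_iSup (fun μ : InvMeasure T => metricEntropy T μ.meas) μ⟩

/-- Saturation is applied to a segment ending at `μ`, which corresponds to parameter 1. Keeping the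
parameter at least `θ` bounds every entropy on the segment below by `θ h_μ`, and [A.3] on `[θ, 1]`
makes the points of its saturated set irregular. -/
lemma mul_metricEntropy_le_topEntropy_irregularSet (hT : Continuous T) (hα : Continuous α)
    (hsat : TransitivelyConvexSaturated T) (hA : ConditionA3 α) {μ ν : InvMeasure T}
    (hμν : α μ ≠ α ν) {θ : I} (hθ : θ < 1) :
    ENNReal.ofReal θ * metricEntropy T μ.meas ≤ topEntropy T (irregularSet α ∩ Tran T) := by
  set K : Set (InvMeasure T) := (fun τ : I => InvMeasure.mix τ μ ν) '' Icc θ 1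
  obtain ⟨-, hG⟩ := hsat K (isCompact_Icc.image (continuous_mix μ ν))
    ((isConnected_Icc hθ.le).image _ (continuous_mix μ ν).continuousOn)
    ⟨2, ![μ, ν], by rintro _ ⟨τ, -, rfl⟩; exact mix_mem_convexSums τ μ ν⟩
  have hnc : ∃ τ ∈ Icc θ 1, α (InvMeasure.mix τ μ ν) ≠ α (InvMeasure.mix 1 μ ν) := by
    by_contra! h
    exact hA μ ν hμν θ 1 hθ ⟨_, h⟩
  obtain ⟨τ, hτ, hne⟩ := hnc
  have hsub : tranSaturatedSet T K ⊆ irregularSet α ∩ Tran T := by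
    rintro x ⟨hx, hxK⟩
    refine ⟨(mem_irregularSet_iff hT hα).2 ⟨_, ?_, _, ?_, hne⟩, hx⟩ <;> rw [hxK]
    · exact mem_image_of_mem _ hτ
    · exact mem_image_of_mem _ (right_mem_Icc.2 hθ.le)
  refine le_trans ?_ (topEntropy_mono hsub)
  rw [hG]
  refine le_iInf₂ ?_
  rintro _ ⟨τ, hτ, rfl⟩
  refine le_trans ?_ (mul_metricEntropy_le_mix τ μ ν)
  gcongr
  exact hτ.1

/-- Let `θ` increase to 1. The limit factor is nonzero, so the product converges even when the
entropy is infinite. -/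
lemma metricEntropy_le_topEntropy_irregularSet (hT : Continuous T) (hα : Continuous α)
    (hsat : TransitivelyConvexSaturated T) (hA : ConditionA3 α) {μ ν : InvMeasure T}
    (hμν : α μ ≠ α ν) : metricEntropy T μ.meas ≤ topEntropy T (irregularSet α ∩ Tran T) := by
  have hlim : Tendsto (fun θ : ℝ => ENNReal.ofReal θ * metricEntropy T μ.meas) (𝓝[<] 1)
      (𝓝 (ENNReal.ofReal 1 * metricEntropy T μ.meas)) :=
    ENNReal.Tendsto.mul_const ((ENNReal.continuous_ofReal.tendsto 1).mono_left nhdsWithin_le_nhds)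
      (Or.inl (by simp))
  rw [ENNReal.ofReal_one, one_mul] at hlim
  refine le_of_tendsto hlim ?_
  filter_upwards [Ioo_mem_nhdsLT (zero_lt_one (α := ℝ))] with θ hθ
  exact mul_metricEntropy_le_topEntropy_irregularSet hT hα hsat hA hμν
    (θ := ⟨θ, hθ.1.le, hθ.2.le⟩) hθ.2

end Saturation

end TopDyn

/-! ### The two parts of the theorem -/

theorem mainTheorem3 {X : Type*} [MetricSpace X] [CompactSpace X] [MeasurableSpace X]
    [BorelSpace X] (T : X → X) (hT : Continuous T)
    (α : TopDyn.InvMeasure T → ℝ) (hα : Continuous α) :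
    (TopDyn.TransitivelyConvexSaturated T → TopDyn.ConditionA3 α →
      TopDyn.irregularSet α = ∅ ∨
        (TopDyn.topEntropy T (TopDyn.irregularSet α ∩ TopDyn.Tran T) =
            TopDyn.topEntropy T (TopDyn.irregularSet α) ∧
          TopDyn.topEntropy T (TopDyn.irregularSet α) = TopDyn.topEntropy T Set.univ)) ∧
    (TopDyn.TransitivelySingleSaturated T → ∀ a : ℝ,
      TopDyn.levelSet α a = ∅ ∨
        (TopDyn.topEntropy T (TopDyn.levelSet α a ∩ TopDyn.Tran T) =
            TopDyn.topEntropy T (TopDyn.levelSet α a) ∧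
          TopDyn.topEntropy T (TopDyn.levelSet α a) =
            ⨆ (ρ : TopDyn.InvMeasure T) (_ : α ρ = a),
              TopDyn.metricEntropy T ρ.meas)) := by

  refine ⟨fun hsat hA => or_iff_not_imp_left.2 fun hne => ?_,
    fun hsat a => Or.inr ?_⟩
  · obtain ⟨x, hx⟩ := nonempty_iff_ne_empty.2 hne
    obtain ⟨μ, -, ν, -, hμν⟩ := (TopDyn.mem_irregularSet_iff hT hα).1 hx
    have h1 := TopDyn.topEntropy_mono (T := T)
      (inter_subset_left : TopDyn.irregularSet α ∩ TopDyn.Tran T ⊆ TopDyn.irregularSet α)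
    have h2 := TopDyn.topEntropy_mono (T := T) (subset_univ (TopDyn.irregularSet α))
    have h3 : TopDyn.topEntropy T univ ≤
        TopDyn.topEntropy T (TopDyn.irregularSet α ∩ TopDyn.Tran T) := by
      refine (TopDyn.topEntropy_univ_le hT).trans (iSup_le fun ρ => ?_)
      -- As `α μ ≠ α ν`, every `ρ` has a partner with a different value of `α`: `ν` in the first
      -- case, `μ` in the second.
      rcases eq_or_ne (α ρ) (α μ) with h | h
      · exact TopDyn.metricEntropy_le_topEntropy_irregularSet hT hα hsat hA (h ▸ hμν)
      · exact TopDyn.metricEntropy_le_topEntropy_irregularSet hT hα hsat hA h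
    exact ⟨le_antisymm h1 (h2.trans h3), le_antisymm h2 (h3.trans h1)⟩
  -- The equalities hold with no case split on emptiness: if no `ρ` has `α ρ = a`, the supremum in
  -- `[0, ∞]` is 0.
  · have h1 := TopDyn.topEntropy_mono (T := T)
      (inter_subset_left : TopDyn.levelSet α a ∩ TopDyn.Tran T ⊆ TopDyn.levelSet α a)
    have h2 : TopDyn.topEntropy T (TopDyn.levelSet α a) ≤
        ⨆ (ρ : TopDyn.InvMeasure T) (_ : α ρ = a), TopDyn.metricEntropy T ρ.meas := by
      refine TopDyn.topEntropy_le_of_forall_exists_limitMeasures hT fun x hx => ?_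
      obtain ⟨μ, hμ⟩ := TopDyn.limitMeasures_nonempty hT x
      exact ⟨μ, hμ, le_iSup₂_of_le μ ((TopDyn.mem_levelSet_iff hT hα).1 hx μ hμ) le_rfl⟩
    have h3 : ⨆ (ρ : TopDyn.InvMeasure T) (_ : α ρ = a), TopDyn.metricEntropy T ρ.meas ≤
        TopDyn.topEntropy T (TopDyn.levelSet α a ∩ TopDyn.Tran T) := by
      refine iSup₂_le fun ρ hρ => ?_
      obtain ⟨-, hG⟩ := hsat ρ
      rw [iInf_singleton] at hG
      rw [← hG]
      refine TopDyn.topEntropy_mono ?_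
      rintro x ⟨hx, hxρ⟩
      refine ⟨(TopDyn.mem_levelSet_iff hT hα).2 fun μ hμ => ?_, hx⟩
      rw [hxρ, mem_singleton_iff] at hμ
      rw [hμ, hρ]
    exact ⟨le_antisymm h1 (h2.trans h3), le_antisymm h2 (h3.trans h1)⟩
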